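/- An electricity division instance with $n$ households consists of a supply $S>0$, demands $D[1],\dots,D[n]>0$ with $D[i]\le S$ for every $i$, and a time interval $[0,T]$ with $T>0$. A schedule is a partition of $[0,T]$ into finitely many subintervals $I_1,\dots,I_p$ together with sets $A_1,\dots,A_p\subseteq\{1,\dots,n\}$ such that $\sum_{i\in A_l}D[i]\le S$ for every $l$; household $i$ is then connected for the time $u_i=\sum_{l:\,i\in A_l}|I_l|$. The egalitarian connection time of the instance is the maximum over all schedules of $\min_i u_i$. For an integer $k\ge 1$, a $k$-times bin packing is a finite sequence of subsets (bins) of $\{1,\dots,n\}$, each of total demand at most $S$, such that every $i$ lies in exactly $k$ bins; $OPT(D_k)$ denotes the least possible number of bins. Let $K(D)$ be the smallest integer $k\ge 1$ such that the egalitarian connection time equals $\frac{k}{OPT(D_k)}\,T$, and let $K(n)$ be the maximum of $K(D)$ over all instances with $n$ households. **Proposition.** $K(6)=9$ (in particular, $K(D)$ exists for every instance with $6$ households). Moreover, the maximum is attained by the instances with $S=9$ and $D=[4,2,5,3,2,1]$: for these, $K(D)=9$ and $OPT(D_9)=17$, and there is a $9$-times bin packing into $17$ bins each of total demand exactly $9$.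 -/

import Mathlib

open Finset

/-- An instance of the electricity division problem with `n` households: a supply `S > 0`, positive
demands `D i`, and a time interval `[0, T]`. No single demand exceeds the supply, since otherwise
that household could never be connected and no bin could contain it. -/
structure ElectricityInstance (n : ℕ) where
  S : ℝ
  D : Fin n → ℝ
  T : ℝ
  S_pos : 0 < S
  D_pos : ∀ i, 0 < D i
  D_le : ∀ i, D i ≤ S
  T_pos : 0 < T

namespace ElectricityInstance

variable {n : ℕ}

/-- A set of households can be connected simultaneously (equivalently: fits into one bin of
capacity `S`). -/
def Feasible (I : ElectricityInstance n) (A : Finset (Fin n)) : Prop :=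
  ∑ i ∈ A, I.D i ≤ I.S

/-- A schedule: a partition `0 = t 0 < t 1 < ⋯ < t p = T` of `[0, T]` into `p` subintervals, and
for each subinterval `l` the set `A l` of households connected during it. -/
structure Schedule (I : ElectricityInstance n) where
  p : ℕ
  t : Fin (p + 1) → ℝ
  t_strictMono : StrictMono t
  t_zero : t 0 = 0
  t_last : t (Fin.last p) = I.T
  A : Fin p → Finset (Fin n)
  feasible : ∀ l, I.Feasible (A l)

/-- The total time during which household `i` is connected. -/
def Schedule.utility {I : ElectricityInstance n} (s : I.Schedule) (i : Fin n) : ℝ :=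
  ∑ l : Fin s.p with i ∈ s.A l, (s.t l.succ - s.t l.castSucc)

/-- `r` is the egalitarian connection time of the instance: the maximum over all schedules of the
minimum over all households of the connection time. -/
def IsEgalitarianTime (I : ElectricityInstance n) (r : ℝ) : Prop :=
  IsGreatest (Set.range fun s : I.Schedule => ⨅ i, s.utility i) r

/-- `B` is a valid `k`-times bin packing with `q` bins: no bin exceeds the capacity, and every item
lies in exactly `k` of the bins (a bin is a set, so it holds an item at most once). -/
def IsPacking (I : ElectricityInstance n) (k : ℕ) {q : ℕ} (B : Fin q → Finset (Fin n)) : Prop :=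
  (∀ j, I.Feasible (B j)) ∧ ∀ i, #{j | i ∈ B j} = k

/-- The optimal (least) number of bins in a `k`-times bin packing. -/
noncomputable def opt (I : ElectricityInstance n) (k : ℕ) : ℕ :=
  sInf {q : ℕ | ∃ B : Fin q → Finset (Fin n), I.IsPacking k B}

/-- A `k`-times bin packing always exists, so that `opt` is a genuine minimum. -/
theorem exists_packing (I : ElectricityInstance n) (k : ℕ) :
    {q : ℕ | ∃ B : Fin q → Finset (Fin n), I.IsPacking k B}.Nonempty := by
  refine ⟨n * k, fun j => {(finProdFinEquiv.symm j).1}, fun j => ?_, fun i => ?_⟩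
  · simpa [Feasible] using I.D_le _
  · have h : #(({i} : Finset (Fin n)) ×ˢ (univ : Finset (Fin k))) = k := by
      rw [card_product, card_singleton, card_univ, Fintype.card_fin, one_mul]
    refine Eq.trans (card_bij (fun j _ => finProdFinEquiv.symm j) ?_ ?_ ?_) h
    · intro a ha
      rw [mem_filter, mem_singleton] at ha
      rw [mem_product, mem_singleton]
      exact ⟨ha.2.symm, mem_univ _⟩
    · intro a _ b _ hab
      exact finProdFinEquiv.symm.injective hab
    · intro b hb
      rw [mem_product, mem_singleton] at hb
      refine ⟨finProdFinEquiv b, ?_, Equiv.symm_apply_apply _ _⟩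
      rw [mem_filter, mem_singleton, Equiv.symm_apply_apply]
      exact ⟨mem_univ _, hb.1.symm⟩

/-- `k`-times bin packing (`k ≥ 1`) yields the optimal electricity division: connecting each bin of
an optimal packing for a fraction `1 / opt k` of the time gives every household the fraction
`k / opt k` of the time `T`, and this is the egalitarian connection time. -/
def IsSolvedBy (I : ElectricityInstance n) (k : ℕ) : Prop :=
  1 ≤ k ∧ I.IsEgalitarianTime ((k : ℝ) / (I.opt k : ℝ) * I.T)

/-- The smallest `k` such that `k`-times bin packing yields the optimal electricity division
(`⊤` if there were no such `k`). -/
noncomputable def leastK (I : ElectricityInstance n) : ℕ∞ :=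
  ⨅ (k : ℕ) (_ : I.IsSolvedBy k), (k : ℕ∞)

end ElectricityInstance

/-- The maximum of `leastK` over all instances with `n` households. The supremum is taken in `ℕ∞`,
so a finite positive value of it means that every `leastK` is finite and that it is attained. -/
noncomputable def maxLeastK (n : ℕ) : ℕ∞ :=
  ⨆ I : ElectricityInstance n, I.leastK

/-! Upper bound. Giving each feasible set its share of time turns a schedule into a fractional cover
of the households, a point of a linear program with one constraint per household. Such a point can
be replaced, at no greater cost, by a basic solution, whose coefficients by Cramer's rule have the
common denominator `|det|` of a 0-1 matrix of order `n`, up to column signs. Clearing that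
denominator `k` gives a `k`-times packing at least as good as the schedule
(`exists_opt_le_of_fractional_cover`). So some `k` up to the maximal 0-1 determinant solves the
instance, and for `n = 6` this determinant is at most 9 (`abs_det_le_nine`).

Determinant bound. Bordering a 0-1 matrix `M` of order 6 gives a sign matrix of order 7 with
determinant `64 * M.det`, so it suffices to stay below `640 = 64 * 10`, that is, to bound the Gram
determinant by `640 ^ 2 = 409600`. After row sign changes the inner products are 3 modulo 4;
Fischer's inequality leaves only a few Gram matrices, whose determinants are computed
(`IsEhlich.det_lt`).

Lower bound. In the given instance the total demand is 17 and `S = 9`, so no packing beats the ratio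
`9 / 17`. The full bins attain it, so a solving `k` satisfies `17 * k = 9 * opt k` and is a multiple
of 9. -/

/-! ### Determinant inequalities for positive semidefinite matrices. -/

section DeterminantInequalities

open Matrix

/-- AM-GM for the eigenvalues, obtained from `x ≤ exp (x - 1)`. -/
theorem Matrix.PosSemidef.det_le_one_of_trace_eq_card {ι : Type*} [Fintype ι] [DecidableEq ι]
    {W : Matrix ι ι ℝ} (hW : W.PosSemidef) (htr : W.trace = Fintype.card ι) : W.det ≤ 1 := by
  have hd : W.det = ∏ i, hW.isHermitian.eigenvalues i := by
    simpa using hW.isHermitian.det_eq_prod_eigenvalues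
  have ht : W.trace = ∑ i, hW.isHermitian.eigenvalues i := by
    simpa using hW.isHermitian.trace_eq_sum_eigenvalues
  calc W.det = ∏ i, hW.isHermitian.eigenvalues i := hd
    _ ≤ ∏ i, Real.exp (hW.isHermitian.eigenvalues i - 1) :=
        prod_le_prod (fun i _ => hW.eigenvalues_nonneg i) fun i _ => by
          simpa using Real.add_one_le_exp (hW.isHermitian.eigenvalues i - 1)
    _ = Real.exp (∑ i, (hW.isHermitian.eigenvalues i - 1)) := (Real.exp_sum _ _).symm
    _ = 1 := by simp [sum_sub_distrib, ← ht, htr]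

/-- With `Q = Bᴴ * B`, congruence by `B⁻¹` turns `G` into a matrix of trace `card ι` and determinant
`G.det / Q.det`. Fischer and Hadamard are the cases of block diagonal and scalar `Q`. -/
theorem Matrix.PosSemidef.det_le_det_of_trace_inv_mul_eq_card {ι : Type*} [Fintype ι]
    [DecidableEq ι] {G Q : Matrix ι ι ℝ} (hG : G.PosSemidef) (hQ : Q.PosDef)
    (htr : (Q⁻¹ * G).trace = Fintype.card ι) : G.det ≤ Q.det := by
  open scoped MatrixOrder in
  obtain ⟨B, hB⟩ := CStarAlgebra.nonneg_iff_eq_star_mul_self.mp hQ.posSemidef.nonneg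
  rw [star_eq_conjTranspose] at hB
  have hQd : Q.det = B.det * B.det := by rw [hB, det_mul, det_conjTranspose]; simp
  have hQpos := hQ.det_pos
  have hB0 : B.det ≠ 0 := by rintro h; rw [hQd, h] at hQpos; simp at hQpos
  have hW := hG.conjTranspose_mul_mul_same B⁻¹
  have h1 : ((B⁻¹)ᴴ * G * B⁻¹).trace = Fintype.card ι := by
    rw [← htr, trace_mul_comm, ← Matrix.mul_assoc, hB, Matrix.mul_inv_rev,
      conjTranspose_nonsing_inv]
  have h2 := hW.det_le_one_of_trace_eq_card h1
  have h3 : ((B⁻¹)ᴴ * G * B⁻¹).det * Q.det = G.det := by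
    rw [det_mul, det_mul, det_conjTranspose, det_nonsing_inv, hQd, Ring.inverse_eq_inv']
    simp only [star_trivial]
    field_simp
  nlinarith

/-- The determinant inequality of Fischer. -/
theorem Matrix.PosSemidef.det_fromBlocks_le {m n : Type*} [Fintype m] [DecidableEq m] [Fintype n]
    [DecidableEq n] {A : Matrix m m ℝ} {B : Matrix m n ℝ} {C : Matrix n m ℝ} {D : Matrix n n ℝ}
    (h : (fromBlocks A B C D).PosSemidef) : (fromBlocks A B C D).det ≤ A.det * D.det := by
  have hA : A.PosSemidef := h.submatrix Sum.inl
  have hD : D.PosSemidef := h.submatrix Sum.inr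
  by_cases h0 : (fromBlocks A B C D).det = 0
  · rw [h0]
    exact mul_nonneg hA.det_nonneg hD.det_nonneg
  have hp := h.posDef_iff_det_ne_zero.mpr h0
  have hA' : A.PosDef := hp.submatrix Sum.inl_injective
  have hD' : D.PosDef := hp.submatrix Sum.inr_injective
  have hAu : IsUnit A.det := hA'.det_pos.ne'.isUnit
  have hDu : IsUnit D.det := hD'.det_pos.ne'.isUnit
  have := invertibleOfIsUnitDet A hAu
  have := invertibleOfIsUnitDet D hDu
  have hQs : (fromBlocks A 0 0 D).PosSemidef := by
    have := (hA'.fromBlocks₁₁ (0 : Matrix m n ℝ) D).2 (by simpa using hD)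
    simpa using this
  have hQd : (fromBlocks A 0 0 D).det = A.det * D.det := det_fromBlocks_zero₂₁ _ _ _
  have hQ : (fromBlocks A 0 0 D).PosDef :=
    hQs.posDef_iff_det_ne_zero.mpr (by rw [hQd]; exact mul_ne_zero hAu.ne_zero hDu.ne_zero)
  have hinv : (fromBlocks A 0 0 D)⁻¹ = fromBlocks A⁻¹ 0 0 D⁻¹ := by
    apply inv_eq_right_inv
    rw [fromBlocks_multiply]
    simp [mul_nonsing_inv _ hAu, mul_nonsing_inv _ hDu]
  rw [← hQd]
  -- The trace sees only the diagonal blocks `A⁻¹ * A` and `D⁻¹ * D`, both identities.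
  refine h.det_le_det_of_trace_inv_mul_eq_card hQ ?_
  rw [hinv, fromBlocks_multiply]
  simp [nonsing_inv_mul _ hAu, nonsing_inv_mul _ hDu, Matrix.trace, Fintype.sum_sum_type]

/-- Hadamard's inequality for a matrix with constant diagonal. -/
theorem Matrix.PosSemidef.det_le_pow_card {ι : Type*} [Fintype ι] [DecidableEq ι]
    {G : Matrix ι ι ℝ} (hG : G.PosSemidef) {d : ℝ} (hd : 0 < d) (hdiag : ∀ i, G i i = d) :
    G.det ≤ d ^ Fintype.card ι := by
  have hQ : (d • (1 : Matrix ι ι ℝ)).PosDef := PosDef.one.smul hd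
  have hinv : (d • (1 : Matrix ι ι ℝ))⁻¹ = d⁻¹ • 1 := by
    apply inv_eq_right_inv
    simp [smul_smul, hd.ne']
  have := hG.det_le_det_of_trace_inv_mul_eq_card hQ (by
    rw [hinv]; simp [Matrix.trace, hdiag, hd.ne'])
  simpa [det_smul] using this

theorem exists_sum_equiv_extending {k l : ℕ} {α : Type*} [Fintype α] (hα : Fintype.card α = k + l)
    {f : Fin k → α} (hf : Function.Injective f) :
    ∃ e : Fin k ⊕ Fin l ≃ α, ∀ i, e (Sum.inl i) = f i := by
  classical
  have hc : Fintype.card ((Set.range f)ᶜ : Set α) = l := by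
    rw [Fintype.card_compl_set, Set.card_range_of_injective hf, hα, Fintype.card_fin]; simp
  refine ⟨(Equiv.sumCongr (Equiv.ofInjective f hf) (Fintype.equivFinOfCardEq hc).symm).trans
    (Equiv.Set.sumCompl (Set.range f)), fun i => ?_⟩
  simp

theorem Matrix.PosSemidef.exists_det_le_mul {k l : ℕ} {α : Type*} [Fintype α] [DecidableEq α]
    (hα : Fintype.card α = k + l) {G : Matrix α α ℝ} (hG : G.PosSemidef) {f : Fin k → α}
    (hf : Function.Injective f) : ∃ g : Fin l → α, Function.Injective g ∧ (∀ i j, f i ≠ g j) ∧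
      G.det ≤ (G.submatrix f f).det * (G.submatrix g g).det := by
  obtain ⟨e, he⟩ := exists_sum_equiv_extending hα hf
  obtain rfl : f = e ∘ Sum.inl := funext fun i => (he i).symm
  refine ⟨e ∘ Sum.inr, e.injective.comp Sum.inr_injective, fun i j h => ?_, ?_⟩
  · simpa using e.injective h
  · rw [← det_submatrix_equiv_self e G]
    have h := hG.submatrix e
    rw [← fromBlocks_toBlocks (G.submatrix e e)] at h ⊢
    exact h.det_fromBlocks_le

end DeterminantInequalities

/-! ### Gram matrices of order 7 with entries 3 modulo 4. -/

section GramBound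

open Matrix

/-- The matrix with diagonal entries `7`, with `3` at the positions exchanged by `σ`, and with `-1`
elsewhere. -/
def pairingMatrix (σ : Equiv.Perm (Fin 7)) : Matrix (Fin 7) (Fin 7) ℤ :=
  .of fun i j => if i = j then 7 else if σ i = j then 3 else -1

/-- The matrix with diagonal entries `7`, off-diagonal entries `3` in the leading `3 × 3` block, and
`-1` elsewhere. -/
def triangleMatrix : Matrix (Fin 7) (Fin 7) ℤ :=
  .of fun i j => if i = j then 7 else if i < 3 ∧ j < 3 then 3 else -1

/-- Certificate for a determinant: `L` records a fraction-free Gaussian elimination, so its diagonal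
need not be 1. -/
theorem det_mul_eq_of_mul_eq_upperTriangular {n : ℕ} {L M U : Matrix (Fin n) (Fin n) ℤ}
    (h : L * M = U) (hL : ∀ i j, j ≤ i ∨ L i j = 0) (hU : ∀ i j, i ≤ j ∨ U i j = 0) :
    (∏ i, L i i) * M.det = ∏ i, U i i := by
  rw [← det_of_isLowerTriangular L fun i j hij => (hL i j).resolve_left (not_le.2 hij),
    ← det_of_isUpperTriangular fun i j hij => (hU i j).resolve_left (not_le.2 hij), ← h, det_mul]

set_option maxRecDepth 10000 in
theorem det_pairingMatrix_one : (pairingMatrix 1).det = 262144 := by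
  have := det_mul_eq_of_mul_eq_upperTriangular (M := pairingMatrix 1)
    (L := !![1, 0, 0, 0, 0, 0, 0; 1, 7, 0, 0, 0, 0, 0; 1, 1, 6, 0, 0, 0, 0;
      1, 1, 1, 5, 0, 0, 0; 1, 1, 1, 1, 4, 0, 0; 1, 1, 1, 1, 1, 3, 0;
      1, 1, 1, 1, 1, 1, 2])
    (U := !![7, -1, -1, -1, -1, -1, -1; 0, 48, -8, -8, -8, -8, -8; 0, 0, 40, -8, -8, -8, -8;
      0, 0, 0, 32, -8, -8, -8; 0, 0, 0, 0, 24, -8, -8; 0, 0, 0, 0, 0, 16, -8;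
      0, 0, 0, 0, 0, 0, 8])
    (by decide) (by simp [Fin.forall_fin_succ]) (by simp [Fin.forall_fin_succ])
  simp [Fin.prod_univ_succ] at this
  omega

set_option maxRecDepth 10000 in
theorem det_pairingMatrix_one_pair : (pairingMatrix (Equiv.swap 0 1)).det = 327680 := by
  have := det_mul_eq_of_mul_eq_upperTriangular (M := pairingMatrix (Equiv.swap 0 1))
    (L := !![1, 0, 0, 0, 0, 0, 0; -3, 7, 0, 0, 0, 0, 0; 1, 1, 10, 0, 0, 0, 0;
      2, 2, 3, 17, 0, 0, 0; 2, 2, 3, 3, 14, 0, 0; 2, 2, 3, 3, 3, 11, 0;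
      2, 2, 3, 3, 3, 3, 8])
    (U := !![7, 3, -1, -1, -1, -1, -1; 0, 40, -4, -4, -4, -4, -4; 0, 0, 68, -12, -12, -12, -12;
      0, 0, 0, 112, -24, -24, -24; 0, 0, 0, 0, 88, -24, -24; 0, 0, 0, 0, 0, 64, -24;
      0, 0, 0, 0, 0, 0, 40])
    (by decide) (by simp [Fin.forall_fin_succ]) (by simp [Fin.forall_fin_succ])
  simp [Fin.prod_univ_succ] at this
  omega

set_option maxRecDepth 10000 in
theorem det_pairingMatrix_two_pairs :
    (pairingMatrix (Equiv.swap 0 1 * Equiv.swap 2 3)).det = 344064 := by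
  have := det_mul_eq_of_mul_eq_upperTriangular
    (M := pairingMatrix (Equiv.swap 0 1 * Equiv.swap 2 3))
    (L := !![1, 0, 0, 0, 0, 0, 0; -3, 7, 0, 0, 0, 0, 0; 1, 1, 10, 0, 0, 0, 0;
      1, 1, -7, 17, 0, 0, 0; 1, 1, 1, 1, 8, 0, 0; 2, 2, 2, 2, 3, 13, 0;
      2, 2, 2, 2, 3, 3, 10])
    (U := !![7, 3, -1, -1, -1, -1, -1; 0, 40, -4, -4, -4, -4, -4; 0, 0, 68, 28, -12, -12, -12;
      0, 0, 0, 96, -12, -12, -12; 0, 0, 0, 0, 52, -12, -12; 0, 0, 0, 0, 0, 80, -24;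
      0, 0, 0, 0, 0, 0, 56])
    (by decide) (by simp [Fin.forall_fin_succ]) (by simp [Fin.forall_fin_succ])
  simp [Fin.prod_univ_succ] at this
  omega

set_option maxRecDepth 10000 in
theorem det_pairingMatrix_three_pairs :
    (pairingMatrix (Equiv.swap 0 1 * Equiv.swap 2 3 * Equiv.swap 4 5)).det = 331776 := by
  have := det_mul_eq_of_mul_eq_upperTriangular
    (M := pairingMatrix (Equiv.swap 0 1 * Equiv.swap 2 3 * Equiv.swap 4 5))
    (L := !![1, 0, 0, 0, 0, 0, 0; -3, 7, 0, 0, 0, 0, 0; 1, 1, 10, 0, 0, 0, 0;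
      1, 1, -7, 17, 0, 0, 0; 1, 1, 1, 1, 8, 0, 0; 1, 1, 1, 1, -5, 13, 0;
      1, 1, 1, 1, 1, 1, 6])
    (U := !![7, 3, -1, -1, -1, -1, -1; 0, 40, -4, -4, -4, -4, -4; 0, 0, 68, 28, -12, -12, -12;
      0, 0, 0, 96, -12, -12, -12; 0, 0, 0, 0, 52, 20, -12; 0, 0, 0, 0, 0, 72, -12;
      0, 0, 0, 0, 0, 0, 36])
    (by decide) (by simp [Fin.forall_fin_succ]) (by simp [Fin.forall_fin_succ])
  simp [Fin.prod_univ_succ] at this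
  omega

set_option maxRecDepth 10000 in
theorem det_triangleMatrix : (triangleMatrix).det = 327680 := by
  have := det_mul_eq_of_mul_eq_upperTriangular (M := triangleMatrix)
    (L := !![1, 0, 0, 0, 0, 0, 0; -3, 7, 0, 0, 0, 0, 0; -3, -3, 10, 0, 0, 0, 0;
      1, 1, 1, 13, 0, 0, 0; 1, 1, 1, 2, 11, 0, 0; 1, 1, 1, 2, 2, 9, 0;
      1, 1, 1, 2, 2, 2, 7])
    (U := !![7, 3, 3, -1, -1, -1, -1; 0, 40, 12, -4, -4, -4, -4; 0, 0, 52, -4, -4, -4, -4;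
      0, 0, 0, 88, -16, -16, -16; 0, 0, 0, 0, 72, -16, -16; 0, 0, 0, 0, 0, 56, -16;
      0, 0, 0, 0, 0, 0, 40])
    (by decide) (by simp [Fin.forall_fin_succ]) (by simp [Fin.forall_fin_succ])
  simp [Fin.prod_univ_succ] at this
  omega

theorem det_four (a b c d e f : ℝ) :
    !![7, a, b, c; a, 7, d, e; b, d, 7, f; c, e, f, 7].det =
      7 ^ 4 - 49 * (a ^ 2 + b ^ 2 + c ^ 2 + d ^ 2 + e ^ 2 + f ^ 2)
        + 14 * (a * b * d + a * c * e + b * c * f + d * e * f)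
        + a ^ 2 * f ^ 2 + b ^ 2 * e ^ 2 + c ^ 2 * d ^ 2
        - 2 * (a * b * e * f + a * c * d * f + b * c * d * e) := by
  simp [Matrix.det_succ_row_zero, Fin.sum_univ_succ, Fin.succAbove]
  ring

theorem det_three (a b c : ℝ) :
    !![7, a, b; a, 7, c; b, c, 7].det = 343 - 7 * (a ^ 2 + b ^ 2 + c ^ 2) + 2 * a * b * c := by
  rw [Matrix.det_fin_three]
  simp
  ring

theorem submatrix_three {α : Type*} {G : Matrix α α ℝ} (hs : ∀ x y, G x y = G y x)
    (hd : ∀ x, G x x = 7) (f : Fin 3 → α) :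
    G.submatrix f f = !![7, G (f 0) (f 1), G (f 0) (f 2); G (f 0) (f 1), 7, G (f 1) (f 2);
      G (f 0) (f 2), G (f 1) (f 2), 7] := by
  ext i j
  fin_cases i <;> fin_cases j <;> first | exact hd _ | rfl | exact hs _ _

theorem submatrix_four {α : Type*} {G : Matrix α α ℝ} (hs : ∀ x y, G x y = G y x)
    (hd : ∀ x, G x x = 7) (f : Fin 4 → α) :
    G.submatrix f f = !![7, G (f 0) (f 1), G (f 0) (f 2), G (f 0) (f 3);
      G (f 0) (f 1), 7, G (f 1) (f 2), G (f 1) (f 3);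
      G (f 0) (f 2), G (f 1) (f 2), 7, G (f 2) (f 3);
      G (f 0) (f 3), G (f 1) (f 3), G (f 2) (f 3), 7] := by
  ext i j
  fin_cases i <;> fin_cases j <;> first | exact hd _ | rfl | exact hs _ _

theorem det_four_le {a b c d e f : ℝ} (ha : a = -1 ∨ a = 3) (hb : b = -1 ∨ b = 3)
    (hc : c = -1 ∨ c = 3) (hd : d = -1 ∨ d = 3) (he : e = -1 ∨ e = 3) (hf : f = -1 ∨ f = 3) :
    !![7, a, b, c; a, 7, d, e; b, d, 7, f; c, e, f, 7].det ≤ 1792 ∨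
      (!![7, a, b, c; a, 7, d, e; b, d, 7, f; c, e, f, 7].det ≤ 2048 ∧
        a = -1 ∧ b = -1 ∧ c = -1 ∧ d = -1 ∧ e = -1 ∧ f = -1) := by
  rw [det_four]
  rcases ha with rfl | rfl <;> rcases hb with rfl | rfl <;> rcases hc with rfl | rfl <;>
  rcases hd with rfl | rfl <;> rcases he with rfl | rfl <;> rcases hf with rfl | rfl <;> norm_num

theorem det_submatrix_four_le {α : Type*} {G : Matrix α α ℝ} (hs : ∀ x y, G x y = G y x)
    (hd : ∀ x, G x x = 7) (ho : ∀ x y, x ≠ y → G x y = -1 ∨ G x y = 3) {f : Fin 4 → α}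
    (hf : Function.Injective f) : (G.submatrix f f).det ≤ 1792 ∨
      ((G.submatrix f f).det ≤ 2048 ∧ ∀ i j, i ≠ j → G (f i) (f j) = -1) := by
  have ho' : ∀ i j, i ≠ j → G (f i) (f j) = -1 ∨ G (f i) (f j) = 3 := fun i j h =>
    ho _ _ (hf.ne h)
  rw [submatrix_four hs hd]
  refine (det_four_le (ho' 0 1 (by decide)) (ho' 0 2 (by decide)) (ho' 0 3 (by decide))
    (ho' 1 2 (by decide)) (ho' 1 3 (by decide)) (ho' 2 3 (by decide))).imp_right fun h => ⟨h.1, ?_⟩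
  obtain ⟨-, h01, h02, h03, h12, h13, h23⟩ := h
  have h10 := (hs _ _).trans h01
  have h20 := (hs _ _).trans h02
  have h30 := (hs _ _).trans h03
  have h21 := (hs _ _).trans h12
  have h31 := (hs _ _).trans h13
  have h32 := (hs _ _).trans h23
  intro i j hij
  fin_cases i <;> fin_cases j <;> first | exact absurd rfl hij | assumption

theorem det_lt_of_eq_map {α : Type*} [Fintype α] [DecidableEq α] {G : Matrix α α ℝ}
    (e : Fin 7 ≃ α) {M : Matrix (Fin 7) (Fin 7) ℤ} (h : ∀ i j, G (e i) (e j) = M i j)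
    (hM : M.det < 409600) : G.det < 409600 := by
  rw [← det_submatrix_equiv_self e G, show G.submatrix e e = M.map (Int.castRingHom ℝ) from
    Matrix.ext h, ← RingHom.mapMatrix_apply, ← RingHom.map_det, eq_intCast]
  exact_mod_cast hM

set_option maxRecDepth 10000 in
-- Involutions of seven points are conjugate when they exchange equally many pairs, at most three.
-- Relabelling by the conjugating permutation leaves four explicit matrices.
theorem det_lt_of_pairing {G : Matrix (Fin 7) (Fin 7) ℝ} {f : Fin 7 → Fin 7}
    (hf : Function.Involutive f)
    (hG : ∀ x y, G x y = if x = y then 7 else if f x = y then 3 else -1) : G.det < 409600 := by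
  set σ : Equiv.Perm (Fin 7) := hf.toPerm
  have hσ : σ ^ 2 = 1 := Equiv.ext fun x => by rw [pow_two]; exact hf x
  have hc := Equiv.Perm.cycleType_of_pow_prime_eq_one hσ
  have hle : σ.cycleType.card ≤ 3 := by
    have h7 := σ.sum_cycleType_le
    rw [hc] at h7
    simp at h7
    omega
  have key : ∀ τ : Equiv.Perm (Fin 7), τ.cycleType = σ.cycleType →
      (pairingMatrix τ).det < 409600 → G.det < 409600 := fun τ hτ hdet => by
    obtain ⟨c, hc⟩ := isConj_iff.1 (Equiv.Perm.isConj_iff_cycleType_eq.2 hτ)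
    refine det_lt_of_eq_map c (fun i j => ?_) hdet
    have : f (c i) = c (τ i) := by
      change σ (c i) = _
      rw [← hc]; simp
    simp [hG, pairingMatrix, this]
  generalize σ.cycleType.card = m at hc hle
  interval_cases m
  · exact key 1 (by rw [hc]; decide) (by rw [det_pairingMatrix_one]; norm_num)
  · exact key (Equiv.swap 0 1) (by rw [hc]; decide)
      (by rw [det_pairingMatrix_one_pair]; norm_num)
  · exact key (Equiv.swap 0 1 * Equiv.swap 2 3) (by rw [hc]; decide)
      (by rw [det_pairingMatrix_two_pairs]; norm_num)
  · exact key (Equiv.swap 0 1 * Equiv.swap 2 3 * Equiv.swap 4 5) (by rw [hc]; decide)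
      (by rw [det_pairingMatrix_three_pairs]; norm_num)

theorem det_lt_of_triangle {G : Matrix (Fin 7) (Fin 7) ℝ} (hs : ∀ x y, G x y = G y x)
    (hd : ∀ x, G x x = 7) {f : Fin 3 → Fin 7} (hf : Function.Injective f)
    {g : Fin 4 → Fin 7} (hg : Function.Injective g) (hfg : ∀ i j, f i ≠ g j)
    (h3 : ∀ i j, i ≠ j → G (f i) (f j) = 3) (h1 : ∀ i j, i ≠ j → G (g i) (g j) = -1)
    (h2 : ∀ i j, G (f i) (g j) = -1) : G.det < 409600 := by
  have he : Function.Injective (Fin.append f g) := by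
    rw [Fin.append_injective_iff]
    exact ⟨hf, hg, hfg⟩
  refine det_lt_of_eq_map (Equiv.ofBijective _ (Finite.injective_iff_bijective.1 he))
    (M := triangleMatrix) ?_ (by rw [det_triangleMatrix]; norm_num)
  suffices h : ∀ i j : Fin (3 + 4),
    G (Fin.append f g i) (Fin.append f g j) = (triangleMatrix i j : ℤ) from h
  intro i j
  simp only [triangleMatrix, Matrix.of_apply]
  induction i using Fin.addCases with
  | left i =>
    induction j using Fin.addCases with
    | left j =>
      rw [Fin.append_left, Fin.append_left]
      by_cases h : i = j
      · simp [h, hd]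
      · rw [h3 i j h]
        fin_cases i <;> fin_cases j <;> simp at h ⊢
    | right j =>
      rw [Fin.append_left, Fin.append_right, h2]
      fin_cases i <;> fin_cases j <;> simp
  | right i =>
    induction j using Fin.addCases with
    | left j =>
      rw [Fin.append_left, Fin.append_right, hs, h2]
      fin_cases i <;> fin_cases j <;> simp
    | right j =>
      rw [Fin.append_right, Fin.append_right]
      by_cases h : i = j
      · simp [h, hd]
      · rw [h1 i j h]
        fin_cases i <;> fin_cases j <;> simp at h ⊢

/-- A positive semidefinite matrix of order `7` with diagonal `7` whose off-diagonal entries are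
integers of `[-7, 7]` congruent to `3` modulo `4`. -/
structure IsEhlich (G : Matrix (Fin 7) (Fin 7) ℝ) : Prop where
  posSemidef : G.PosSemidef
  diag : ∀ x, G x x = 7
  off_diag : ∀ x y, x ≠ y → G x y = -5 ∨ G x y = -1 ∨ G x y = 3 ∨ G x y = 7

theorem IsEhlich.det_lt {G : Matrix (Fin 7) (Fin 7) ℝ} (hG : IsEhlich G) : G.det < 409600 := by
  have hP := hG.posSemidef
  have hd := hG.diag
  have hs : ∀ x y, G x y = G y x := fun x y => by simpa using (hP.isHermitian.apply x y).symm
  by_contra! hdet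
  have ho : ∀ x y, x ≠ y → G x y = -1 ∨ G x y = 3 := by
    intro x y hxy
    have hinj : Function.Injective ![x, y] := by
      intro i j h
      fin_cases i <;> fin_cases j <;> simp_all [eq_comm]
    obtain ⟨g, -, -, h⟩ := hP.exists_det_le_mul (k := 2) (l := 5) (by simp) hinj
    have h5 := (hP.submatrix g).det_le_pow_card (d := 7) (by norm_num) fun i => hd _
    have h0 := (hP.submatrix g).det_nonneg
    have h2 : (G.submatrix ![x, y] ![x, y]).det = 49 - G x y ^ 2 := by
      rw [Matrix.det_fin_two]
      simp [hd, hs y x]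
      ring
    rw [h2] at h
    norm_num at h5
    -- An entry -5 gives at most `24 * 7 ^ 5 = 403368`, and an entry 7 gives 0.
    rcases hG.off_diag x y hxy with h' | h' | h' | h' <;> rw [h'] at h <;> norm_num at h
    · linarith
    · exact Or.inl h'
    · exact Or.inr h'
    · linarith
  have inj3 : ∀ {x y z : Fin 7}, x ≠ y → y ≠ z → x ≠ z → Function.Injective ![x, y, z] := by
    intro x y z h1 h2 h3 i j h
    fin_cases i <;> fin_cases j <;> simp_all [eq_comm]
  -- A triple with entries 3, 3, -1 has determinant 192, and `192 * 2048 < 409600`.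
  have htrans : ∀ x y z, x ≠ z → x ≠ y → y ≠ z → G x y = 3 → G y z = 3 → G x z = 3 := by
    intro x y z hxz hxy hyz h1 h2
    refine (ho x z hxz).resolve_left fun h3 => ?_
    obtain ⟨g, hg, -, h⟩ := hP.exists_det_le_mul (k := 3) (l := 4) (by simp) (inj3 hxy hyz hxz)
    rw [submatrix_three hs hd, det_three] at h
    simp [h1, h2, h3] at h
    norm_num at h
    rcases det_submatrix_four_le hs hd ho hg with h4 | ⟨h4, -⟩ <;> linarith
  by_cases htri : ∃ x y z, x ≠ y ∧ y ≠ z ∧ x ≠ z ∧ G x y = 3 ∧ G y z = 3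
  · obtain ⟨x, y, z, hxy, hyz, hxz, h1, h2⟩ := htri
    have h3 := htrans x y z hxz hxy hyz h1 h2
    have hf := inj3 hxy hyz hxz
    obtain ⟨g, hg, hfg, h⟩ := hP.exists_det_le_mul (k := 3) (l := 4) (by simp) hf
    rw [submatrix_three hs hd, det_three] at h
    simp [h1, h2, h3] at h
    norm_num at h
    -- The triangle of 3's has determinant 208. As `208 * 1792 < 409600 < 208 * 2048`, the other
    -- four indices must have all mutual entries -1.
    rcases det_submatrix_four_le hs hd ho hg with h4 | ⟨-, h4⟩
    · linarith
    have hxg : ∀ j, x ≠ g j := hfg 0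
    have hyg : ∀ j, y ≠ g j := hfg 1
    have hzg : ∀ j, z ≠ g j := hfg 2
    have hclique : ∀ j, G x (g j) = -1 := by
      intro j
      refine (ho _ _ (hxg j)).resolve_right fun hx => ?_
      have hy := htrans y x (g j) (hyg j) hxy.symm (hxg j) (hs y x ▸ h1) hx
      have hz := htrans z x (g j) (hzg j) hxz.symm (hxg j) (hs z x ▸ h3) hx
      -- A fourth index joined to the triangle would give a block of determinant 1024, and `1024 * 7
      -- ^ 3 < 409600`.
      have hf4 : Function.Injective ![x, y, z, g j] := by
        intro a b hab
        have := hxg j; have := hyg j; have := hzg j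
        fin_cases a <;> fin_cases b <;> simp_all [eq_comm]
      obtain ⟨g', -, -, h'⟩ := hP.exists_det_le_mul (k := 4) (l := 3) (by simp) hf4
      have h5 := (hP.submatrix g').det_le_pow_card (d := 7) (by norm_num) fun i => hd _
      rw [submatrix_four hs hd, det_four] at h'
      simp [h1, h2, h3, hx, hy, hz] at h'
      norm_num at h' h5
      linarith
    refine absurd hdet (not_le.2 (det_lt_of_triangle hs hd hf hg hfg ?_ h4 ?_))
    · have h1' := hs y x ▸ h1
      have h2' := hs z y ▸ h2
      have h3' := hs z x ▸ h3
      intro i j hij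
      fin_cases i <;> fin_cases j <;> first | exact absurd rfl hij | assumption
    · intro i j
      have hy : G y (g j) = -1 := (ho _ _ (hyg j)).resolve_right fun hy => by
        have := htrans x y (g j) (hxg j) hxy (hyg j) h1 hy
        rw [hclique j] at this
        norm_num at this
      have hz : G z (g j) = -1 := (ho _ _ (hzg j)).resolve_right fun hz => by
        have := htrans x z (g j) (hxg j) hxz (hzg j) h3 hz
        rw [hclique j] at this
        norm_num at this
      have hx := hclique j
      fin_cases i <;> assumption
  · push Not at htri
    classical
    -- Without two 3's meeting at an index, the entries 3 form a matching; `f` exchanges partners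
    -- and fixes unmatched indices.
    let f : Fin 7 → Fin 7 := fun x => if h : ∃ y, x ≠ y ∧ G x y = 3 then h.choose else x
    have hf1 : ∀ x y, x ≠ y → G x y = 3 → f x = y := by
      intro x y hxy h
      have hex : ∃ y, x ≠ y ∧ G x y = 3 := ⟨y, hxy, h⟩
      have hfx : f x = hex.choose := dif_pos hex
      rw [hfx]
      by_contra hne
      refine htri hex.choose x y hex.choose_spec.1.symm hxy hne ?_ h
      rw [hs]; exact hex.choose_spec.2
    have hf2 : ∀ x, f x = x ∨ (x ≠ f x ∧ G x (f x) = 3) := by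
      intro x
      by_cases hex : ∃ y, x ≠ y ∧ G x y = 3
      · have hfx : f x = hex.choose := dif_pos hex
        rw [hfx]
        exact Or.inr hex.choose_spec
      · exact Or.inl (dif_neg hex)
    refine absurd hdet (not_le.2 (det_lt_of_pairing (f := f) (fun x => ?_) fun x y => ?_))
    · rcases hf2 x with h | ⟨h, h'⟩
      · rw [h, h]
      · exact hf1 _ _ h.symm (by rw [hs]; exact h')
    · split_ifs with h h'
      · rw [h, hd]
      · rcases hf2 x with h'' | ⟨-, h''⟩
        · exact absurd (h''.symm.trans h') h
        · rwa [h'] at h''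
      · exact (ho x y h).resolve_right fun h3 => h' (hf1 x y h h3)

end GramBound

/-! ### From sign matrices of order 7 to 0-1 matrices of order 6. -/

section MaximalDeterminant

open Matrix

/-- Each `(1 - u i) * (1 - v i)` is 0 or 4; expanding the sum gives an inner product congruent to `1
+ 1 - 7`, that is, to 3 modulo 4. -/
theorem sum_mul_eq_of_sign {u v : Fin 7 → ℤ} (hu : ∀ i, u i = 1 ∨ u i = -1)
    (hv : ∀ i, v i = 1 ∨ v i = -1) (hu4 : (∑ i, u i) % 4 = 1) (hv4 : (∑ i, v i) % 4 = 1) :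
    ∑ i, u i * v i = -5 ∨ ∑ i, u i * v i = -1 ∨ ∑ i, u i * v i = 3 ∨ ∑ i, u i * v i = 7 := by
  have h4 : (4 : ℤ) ∣ ∑ i, (1 - u i) * (1 - v i) := dvd_sum fun i _ => by
    rcases hu i with h | h <;> rcases hv i with h' | h' <;> simp [h, h']
  have hexp : ∑ i, (1 - u i) * (1 - v i) = 7 - ∑ i, u i - ∑ i, v i + ∑ i, u i * v i := by
    rw [show (7 : ℤ) = ∑ _i : Fin 7, 1 by simp, ← sum_sub_distrib, ← sum_sub_distrib,
      ← sum_add_distrib]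
    exact sum_congr rfl fun i _ => by ring
  have hle : ∑ i, u i * v i ≤ ∑ _i : Fin 7, 1 := sum_le_sum fun i _ => by
    rcases hu i with h | h <;> rcases hv i with h' | h' <;> simp [h, h']
  have hge : ∑ _i : Fin 7, (-1) ≤ ∑ i, u i * v i := sum_le_sum fun i _ => by
    rcases hu i with h | h <;> rcases hv i with h' | h' <;> simp [h, h']
  simp only [sum_const, card_univ, Fintype.card_fin, nsmul_eq_mul, Nat.cast_ofNat] at hle hge
  omega

theorem det_sq_lt_of_sign {R : Matrix (Fin 7) (Fin 7) ℤ} (hR : ∀ i j, R i j = 1 ∨ R i j = -1) :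
    R.det ^ 2 < 409600 := by
  -- A sum of seven signs is odd, so it or its negative is 1 modulo 4.
  have hs : ∀ i, ∃ s : ℤ, (s = 1 ∨ s = -1) ∧ (∑ j, s * R i j) % 4 = 1 := by
    intro i
    have h2 : (2 : ℤ) ∣ ∑ j, (1 - R i j) := dvd_sum fun j _ => by
      rcases hR i j with h | h <;> simp [h]
    rw [sum_sub_distrib] at h2
    simp only [sum_const, card_univ, Fintype.card_fin, nsmul_eq_mul, Nat.cast_ofNat] at h2
    simp only [← mul_sum]
    by_cases h : (∑ j, R i j) % 4 = 1
    · exact ⟨1, Or.inl rfl, by omega⟩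
    · exact ⟨-1, Or.inr rfl, by omega⟩
  choose s hs1 hs4 using hs
  set P : Matrix (Fin 7) (Fin 7) ℤ := diagonal s * R with hP
  have hPa : ∀ i j, P i j = s i * R i j := fun i j => by simp [hP, diagonal_mul]
  have hP1 : ∀ i j, P i j = 1 ∨ P i j = -1 := fun i j => by
    rw [hPa]
    rcases hs1 i with h | h <;> rcases hR i j with h' | h' <;> simp [h, h']
  have hPdet : P.det ^ 2 = R.det ^ 2 := by
    rw [hP, det_mul, det_diagonal, mul_pow, ← prod_pow, prod_eq_one, one_mul]
    intro i _
    rcases hs1 i with h | h <;> simp [h]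
  set Q : Matrix (Fin 7) (Fin 7) ℝ := P.map (Int.castRingHom ℝ) with hQ
  have hQQ : ∀ x y, (Q * Qᵀ) x y = ((∑ j, P x j * P y j : ℤ) : ℝ) := fun x y => by
    simp [Matrix.mul_apply, hQ]
  have hE : IsEhlich (Q * Qᵀ) := by
    refine ⟨?_, fun x => ?_, fun x y _ => ?_⟩
    · simpa using posSemidef_self_mul_conjTranspose Q
    · rw [hQQ, sum_congr rfl fun j _ => (by rcases hP1 x j with h | h <;> simp [h] :
        P x j * P x j = 1)]
      simp
    · rw [hQQ]
      have h4 : ∀ i, (∑ j, P i j) % 4 = 1 := fun i => by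
        simp only [hPa]; exact hs4 i
      exact_mod_cast sum_mul_eq_of_sign (hP1 x) (hP1 y) (h4 x) (h4 y)
  have h := hE.det_lt
  have hQdet : Q.det = P.det := by
    rw [hQ, ← RingHom.mapMatrix_apply, ← RingHom.map_det, eq_intCast]
  rw [det_mul, det_transpose, hQdet, ← sq] at h
  rw [← hPdet]
  exact_mod_cast h

/-- The maximal determinant of a `6 × 6` matrix with entries `0` and `1` is at most `9`. -/
theorem abs_det_le_nine {M : Matrix (Fin 6) (Fin 6) ℤ} (hM : ∀ i j, M i j = 0 ∨ M i j = 1) :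
    |M.det| ≤ 9 := by
  let B : Matrix (Fin 1) (Fin 6) ℤ := .of fun _ _ => 1
  let D : Matrix (Fin 6) (Fin 6) ℤ := .of fun i j => 1 - 2 * M i j
  set R : Matrix (Fin 1 ⊕ Fin 6) (Fin 1 ⊕ Fin 6) ℤ := fromBlocks 1 B Bᵀ D with hR
  have hdet : R.det = 64 * M.det := by
    -- The Schur complement of the corner; its determinant is `(-2) ^ 6 * M.det`.
    have hD : D - Bᵀ * B = (-2 : ℤ) • M := by
      ext i j
      simp [B, D, Matrix.mul_apply]
    rw [hR, det_fromBlocks_one₁₁, hD]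
    rw [det_smul]
    norm_num
  have hsign : ∀ i j, R i j = 1 ∨ R i j = -1 := by
    rintro (i | i) (j | j)
    · simp [hR, Subsingleton.elim i j]
    · simp [hR, B]
    · simp [hR, B]
    · rcases hM i j with h | h <;> simp [hR, D, h]
  have h := det_sq_lt_of_sign (R := R.submatrix (finSumFinEquiv (m := 1) (n := 6)).symm
    (finSumFinEquiv (m := 1) (n := 6)).symm) fun i j => hsign _ _
  rw [det_submatrix_equiv_self finSumFinEquiv.symm R, hdet] at h
  rw [abs_le]
  constructor <;> nlinarith

end MaximalDeterminant

/-! ### Basic solutions of linear programs and Cramer's rule. -/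

section BasicSolutions

/-- Ratio test of the simplex method: move along `-μ` until the first coefficient with `μ c > 0`
reaches 0. -/
theorem exists_nonneg_smaller_support {C V : Type*} [Fintype C] [AddCommGroup V] [Module ℝ V]
    (v : C → V) (cost : C → ℝ) {x μ : C → ℝ} (hx : ∀ c, 0 ≤ x c) (hμv : ∑ c, μ c • v c = 0)
    (hμx : ∀ c, x c = 0 → μ c = 0) (hμc : 0 ≤ ∑ c, μ c * cost c) (hpos : ∃ c, 0 < μ c) :
    ∃ y : C → ℝ, (∀ c, 0 ≤ y c) ∧ ∑ c, y c • v c = ∑ c, x c • v c ∧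
      ∑ c, y c * cost c ≤ ∑ c, x c * cost c ∧
      #{c | y c ≠ 0} < #{c | x c ≠ 0} := by
  obtain ⟨c₁, hc₁⟩ := hpos
  obtain ⟨c₀, hc₀, hmin⟩ := exists_min_image {c | 0 < μ c} (fun c => x c / μ c)
    ⟨c₁, by simpa using hc₁⟩
  rw [mem_filter_univ] at hc₀
  set t := x c₀ / μ c₀
  have ht : 0 ≤ t := div_nonneg (hx _) hc₀.le
  refine ⟨fun c => x c - t * μ c, fun c => ?_, ?_, ?_, ?_⟩
  · rcases le_or_gt (μ c) 0 with h | h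
    · have := mul_nonpos_of_nonneg_of_nonpos ht h
      linarith [hx c]
    · have := (le_div_iff₀ h).1 (hmin c (by simpa using h))
      linarith
  · simp_rw [sub_smul, sum_sub_distrib, mul_smul, ← smul_sum, hμv, smul_zero, sub_zero]
  · simp_rw [sub_mul, sum_sub_distrib, mul_assoc, ← mul_sum]
    linarith [mul_nonneg ht hμc]
  · refine card_lt_card ((ssubset_iff_of_subset fun c => ?_).2 ⟨c₀, ?_, ?_⟩)
    · simp only [mem_filter_univ]
      intro h h0
      exact h (by rw [h0, hμx c h0]; simp)
    · rw [mem_filter_univ]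
      exact fun h => hc₀.ne' (hμx _ h)
    · simp [t, div_mul_cancel₀ _ hc₀.ne']

/-- A nonnegative combination can be replaced, without raising its cost, by one whose support is
linearly independent. -/
theorem exists_nonneg_linearIndepOn_support {C V : Type*} [Fintype C] [AddCommGroup V] [Module ℝ V]
    (v : C → V) {cost : C → ℝ} (hcost : ∀ c, 0 ≤ cost c) (x : C → ℝ) (hx : ∀ c, 0 ≤ x c) :
    ∃ y : C → ℝ, (∀ c, 0 ≤ y c) ∧ ∑ c, y c • v c = ∑ c, x c • v c ∧
      ∑ c, y c * cost c ≤ ∑ c, x c * cost c ∧ LinearIndepOn ℝ v {c | y c ≠ 0} := by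
  induction hn : #{c | x c ≠ 0} using Nat.strong_induction_on generalizing x with
  | _ n ih =>
    by_cases hli : LinearIndepOn ℝ v {c | x c ≠ 0}
    · exact ⟨x, hx, rfl, le_rfl, hli⟩
    suffices h : ∃ μ : C → ℝ, ∑ c, μ c • v c = 0 ∧ (∀ c, x c = 0 → μ c = 0) ∧
        0 ≤ ∑ c, μ c * cost c ∧ ∃ c, 0 < μ c by
      obtain ⟨μ, h1, h2, h3, h4⟩ := h
      obtain ⟨y, hy, hyv, hyc, hlt⟩ := exists_nonneg_smaller_support v cost hx h1 h2 h3 h4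
      obtain ⟨w, hw, hwv, hwc, hli'⟩ := ih _ (hn ▸ hlt) y hy rfl
      exact ⟨w, hw, hwv.trans hyv, hwc.trans hyc, hli'⟩
    have hdep : ∃ μ : C → ℝ, ∑ c, μ c • v c = 0 ∧ (∀ c, x c = 0 → μ c = 0) ∧ ∃ c, μ c ≠ 0 := by
      rw [show {c | x c ≠ 0} = ((univ.filter fun c => x c ≠ 0 : Finset C) : Set C) by simp,
        linearIndepOn_finset_iff] at hli
      push Not at hli
      obtain ⟨f, hf, c, hc, hfc⟩ := hli
      refine ⟨fun c => if x c ≠ 0 then f c else 0, ?_, fun c hc => by simp [hc], c, ?_⟩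
      · rw [sum_filter] at hf
        simpa [ite_smul] using hf
      · rw [mem_filter_univ] at hc
        simpa [hc] using hfc
    obtain ⟨μ, h1, h2, c, hc⟩ := hdep
    have hneg : ∑ c, (-μ) c • v c = 0 := by simp [h1]
    have hneg' : ∑ c, (-μ) c * cost c = -∑ c, μ c * cost c := by simp
    have hpos : ∀ ν : C → ℝ, 0 < ∑ c, ν c * cost c → ∃ c, 0 < ν c := fun ν h => by
      by_contra! h'
      exact h.not_ge (sum_nonpos fun c _ => mul_nonpos_of_nonpos_of_nonneg (h' c) (hcost c))
    -- The sign of `μ` is chosen so that its cost is nonnegative. A positive cost already forces a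
    -- positive coefficient; at cost 0 the sign of a nonzero coefficient decides.
    rcases lt_trichotomy (∑ c, μ c * cost c) 0 with h | h | h
    · have h' : 0 < ∑ c, (-μ) c * cost c := by rw [hneg']; linarith
      exact ⟨-μ, hneg, fun c h => by simp [h2 c h], h'.le, hpos _ h'⟩
    · rcases lt_or_gt_of_ne hc with h' | h'
      · exact ⟨-μ, hneg, fun c h => by simp [h2 c h], by rw [hneg', h]; simp, c, by simpa using h'⟩
      · exact ⟨μ, h1, h2, h.ge, c, h'⟩
    · exact ⟨μ, h1, h2, h.le, hpos _ h⟩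

/-- Cramer's rule: the coefficients of a combination of linearly independent integer vectors that
represents the all-ones vector have a common denominator, the determinant of `n` of the vectors. -/
theorem exists_det_mul_eq_natCast {n : ℕ} {C : Type*} [Fintype C] (v : C → Fin n → ℤ)
    (hspan : Submodule.span ℝ (Set.range fun c i => (v c i : ℝ)) = ⊤)
    {y : C → ℝ} (hy : ∀ c, 0 ≤ y c) (hy1 : ∀ i, ∑ c, y c * v c i = 1)
    (hli : LinearIndepOn ℝ (fun c i => (v c i : ℝ)) {c | y c ≠ 0}) :
    ∃ (e : Fin n → C) (m : C → ℕ), (Matrix.of fun i j => v (e j) i).det ≠ 0 ∧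
      ∀ c, (m c : ℝ) = |((Matrix.of fun i j => v (e j) i).det : ℝ)| * y c := by
  classical
  obtain ⟨b, -, hsb, hb, hbli⟩ := exists_linearIndepOn_extension hli (Set.subset_univ _)
  rw [Set.image_univ] at hb
  have htop : ⊤ ≤ Submodule.span ℝ (Set.range fun c : b => fun i => (v c i : ℝ)) := by
    rw [← hspan, Submodule.span_le]
    refine hb.trans (le_of_eq ?_)
    congr 2
    ext; simp
  have hcard : Fintype.card b = Fintype.card (Fin n) := by
    rw [← Module.finrank_eq_card_basis (Module.Basis.mk hbli htop)]; simp
  obtain e := (Fintype.equivOfCardEq hcard).symm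
  set B : Matrix (Fin n) (Fin n) ℤ := .of fun i j => v (e j) i with hB
  set A : Matrix (Fin n) (Fin n) ℝ := B.map (Int.castRingHom ℝ) with hA
  have hdet : A.det = B.det := by
    rw [hA, ← RingHom.mapMatrix_apply, ← RingHom.map_det, eq_intCast]
  have hu : IsUnit A := by
    rw [← Matrix.linearIndependent_cols_iff_isUnit]
    exact hbli.comp e e.injective
  have hB0 : B.det ≠ 0 := fun h => by
    rw [Matrix.isUnit_iff_isUnit_det, hdet, h] at hu
    simp at hu
  have hAz : A.mulVec (fun j => y (e j)) = fun i => ((1 : ℤ) : ℝ) := by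
    funext i
    rw [Int.cast_one, ← hy1 i]
    simp only [Matrix.mulVec, dotProduct, hA, hB, Matrix.map_apply, Matrix.of_apply, eq_intCast]
    rw [e.sum_comp fun c : b => (v c i : ℝ) * y c, sum_set_coe b (f := fun c => (v c i : ℝ) * y c)]
    simp_rw [mul_comm (y _)]
    refine sum_subset (subset_univ _) fun c _ hc => ?_
    have h0 : y c = 0 := by
      by_contra h
      exact hc (Set.mem_toFinset.2 (hsb h))
    rw [h0, mul_zero]
  -- The adjugate of an integer matrix is integral, so `B.det` clears all denominators.
  have hadj : ∀ j, (B.det : ℝ) * y (e j) = ((B.adjugate.mulVec fun _ => 1) j : ℤ) := by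
    intro j
    have h := congrArg (A.adjugate.mulVec) hAz
    rw [Matrix.mulVec_mulVec, Matrix.adjugate_mul, Matrix.smul_mulVec, Matrix.one_mulVec] at h
    have h' := congrFun h j
    rw [Pi.smul_apply, smul_eq_mul, hdet] at h'
    rw [h', hA, ← RingHom.mapMatrix_apply, ← RingHom.map_adjugate]
    simp [Matrix.mulVec, dotProduct]
  have hm : ∀ c, ∃ m : ℕ, (m : ℝ) = |(B.det : ℝ)| * y c := by
    intro c
    by_cases hc : c ∈ b
    · obtain ⟨j, hj⟩ := e.surjective ⟨c, hc⟩
      refine ⟨((B.adjugate.mulVec fun _ => 1) j).natAbs, ?_⟩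
      rw [Nat.cast_natAbs, Int.cast_abs, ← hadj, abs_mul, abs_of_nonneg (hy _), hj]
    · refine ⟨0, ?_⟩
      have : y c = 0 := by
        by_contra h
        exact hc (hsb h)
      simp [this]
  choose m hm using hm
  exact ⟨fun j => e j, m, hB0, hm⟩

end BasicSolutions

namespace ElectricityInstance

/-! ### From fractional covers to `k`-times packings. -/

section Packing

variable {n : ℕ} {I : ElectricityInstance n}

theorem Feasible.mono {A B : Finset (Fin n)} (hA : I.Feasible A) (h : B ⊆ A) : I.Feasible B :=
  (sum_le_sum_of_subset_of_nonneg h fun i _ _ => (I.D_pos i).le).trans hA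

theorem feasible_singleton (i : Fin n) : I.Feasible {i} := by
  simpa [Feasible] using I.D_le i

/-- A family of bins covering every item at least `k` times can be trimmed to a `k`-times bin
packing. -/
theorem exists_isPacking_of_cover {β : Type*} [Fintype β] {B : β → Finset (Fin n)}
    (hB : ∀ b, I.Feasible (B b)) {k : ℕ} (hk : ∀ i, k ≤ #{b | i ∈ B b}) :
    ∃ B' : Fin (Fintype.card β) → Finset (Fin n), I.IsPacking k B' := by
  classical
  choose s hs hcard using fun i => exists_subset_card_eq (hk i)
  let e := Fintype.equivFin β
  refine ⟨fun j => {i | e.symm j ∈ s i}, fun j => (hB (e.symm j)).mono fun i hi => ?_, fun i => ?_⟩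
  · rw [mem_filter_univ] at hi
    simpa using hs i hi
  · rw [← hcard i]
    refine card_bij (fun j _ => e.symm j) (fun j hj => ?_) (fun _ _ _ _ h => e.symm.injective h)
      fun b hb => ⟨e b, ?_, e.symm_apply_apply b⟩
    · simpa using hj
    · simpa using hb

theorem isPacking_opt (I : ElectricityInstance n) (k : ℕ) :
    ∃ B : Fin (I.opt k) → Finset (Fin n), I.IsPacking k B :=
  Nat.sInf_mem (I.exists_packing k)

theorem opt_le {k q : ℕ} {B : Fin q → Finset (Fin n)} (hB : I.IsPacking k B) : I.opt k ≤ q :=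
  Nat.sInf_le ⟨B, hB⟩

noncomputable instance (I : ElectricityInstance n) : Fintype {A // I.Feasible A} :=
  Fintype.ofFinite _

/-- The columns of the covering program in standard form: feasible sets and slack columns. -/
def column (I : ElectricityInstance n) : {A // I.Feasible A} ⊕ Fin n → Fin n → ℤ :=
  Sum.elim (fun A i => if i ∈ A.1 then 1 else 0) fun j => Pi.single j (-1)

theorem span_column (I : ElectricityInstance n) :
    Submodule.span ℝ (Set.range fun c i => (I.column c i : ℝ)) = ⊤ := by
  rw [eq_top_iff, ← (Pi.basisFun ℝ (Fin n)).span_eq, Submodule.span_le]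
  rintro _ ⟨j, rfl⟩
  refine Submodule.subset_span ⟨Sum.inl ⟨{j}, feasible_singleton j⟩, ?_⟩
  funext i
  simp [column, Pi.single_apply]

/-- Negating the slack columns makes the matrix 0-1 and preserves the absolute determinant. -/
theorem abs_det_column_le {N : ℤ} (hN : ∀ M : Matrix (Fin n) (Fin n) ℤ,
    (∀ i j, M i j = 0 ∨ M i j = 1) → |M.det| ≤ N) (e : Fin n → {A // I.Feasible A} ⊕ Fin n) :
    |(Matrix.of fun i j => I.column (e j) i).det| ≤ N := by
  let s : {A // I.Feasible A} ⊕ Fin n → ℤ := Sum.elim (fun _ => 1) fun _ => -1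
  have hs : ∀ c, |s c| = 1 := by rintro (c | c) <;> simp [s]
  have hsc : ∀ c i, s c * I.column c i = 0 ∨ s c * I.column c i = 1 := by
    rintro (c | c) i
    · by_cases h : i ∈ c.1 <;> simp [s, column, h]
    · by_cases h : i = c <;> simp [s, column, h]
  have h := hN (.of fun i j => s (e j) * I.column (e j) i) fun i j => hsc (e j) i
  have h' := Matrix.det_mul_row (fun j => s (e j)) (Matrix.of fun i j => I.column (e j) i)
  simp only [Matrix.of_apply] at h'
  rw [h', abs_mul, abs_prod] at h
  simpa [hs] using h

/-- A fractional covering by feasible sets is never better than the `k`-times bin packings with `k`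
up to the maximal determinant of a `0`-`1` matrix of order `n`. -/
theorem exists_opt_le_of_fractional_cover {N : ℕ} (hN : ∀ M : Matrix (Fin n) (Fin n) ℤ,
    (∀ i j, M i j = 0 ∨ M i j = 1) → |M.det| ≤ N) {x : {A // I.Feasible A} → ℝ}
    (hx : ∀ A, 0 ≤ x A) (hcov : ∀ i, 1 ≤ ∑ A, if i ∈ A.1 then x A else 0) :
    ∃ k, 1 ≤ k ∧ k ≤ N ∧ (I.opt k : ℝ) ≤ k * ∑ A, x A := by
  classical
  obtain ⟨y, hy, hyv, hyc, hli⟩ := exists_nonneg_linearIndepOn_support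
    (fun c i => (I.column c i : ℝ)) (cost := Sum.elim (fun _ => 1) fun _ => 0)
    (by rintro (c | c) <;> simp)
    (Sum.elim x fun i => (∑ A, if i ∈ A.1 then x A else 0) - 1)
    (by rintro (c | c); exacts [hx c, by simpa using hcov c])
  have hx1 : ∀ i, ∑ c, y c * I.column c i = 1 := fun i => by
    have h := congrFun hyv i
    simp only [Finset.sum_apply, Pi.smul_apply, smul_eq_mul] at h
    rw [h]
    simp [Fintype.sum_sum_type, column, Pi.single_apply]
  obtain ⟨e, m, hdet, hm⟩ := exists_det_mul_eq_natCast I.column I.span_column hy hx1 hli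
  have hle := abs_det_column_le hN e
  set d := (Matrix.of fun i j => I.column (e j) i).det
  have hd : ((d.natAbs : ℕ) : ℝ) = |(d : ℝ)| := by rw [Nat.cast_natAbs, Int.cast_abs]
  -- Take `m A = |d| * y A` copies of each bin `A`. Slack columns contribute nonpositively to the
  -- equation at `i`, so the bins alone cover `i` at least `|d|` times.
  have hcover : ∀ i, d.natAbs ≤
      #{b : Σ A : {A // I.Feasible A}, Fin (m (Sum.inl A)) | i ∈ b.1.1} := by
    intro i
    have hcard : #{b : Σ A : {A // I.Feasible A}, Fin (m (Sum.inl A)) | i ∈ b.1.1} =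
        ∑ A : {A // I.Feasible A}, if i ∈ A.1 then m (Sum.inl A) else 0 := by
      rw [card_filter, Fintype.sum_sigma]
      exact sum_congr rfl fun A _ => by by_cases h : i ∈ A.1 <;> simp [h]
    rw [hcard, ← Nat.cast_le (α := ℝ), hd, ← mul_one |(d : ℝ)|, ← hx1 i, mul_sum]
    push_cast
    rw [Fintype.sum_sum_type]
    refine add_le_of_le_of_nonpos (sum_le_sum fun A _ => ?_) (sum_nonpos fun j _ => ?_)
    · rw [hm]
      by_cases h : i ∈ A.1 <;> simp [column, h]
    · have := mul_nonneg (abs_nonneg (d : ℝ)) (hy (Sum.inr j))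
      by_cases h : i = j <;> simp [column, h]
      subst h; linarith [hm (Sum.inr i)]
  obtain ⟨B, hB⟩ := exists_isPacking_of_cover (fun b => b.1.2) hcover
  refine ⟨d.natAbs, Int.natAbs_pos.2 hdet, by rwa [← Nat.cast_le (α := ℤ), Int.natCast_natAbs], ?_⟩
  calc (I.opt d.natAbs : ℝ) ≤ _ := Nat.cast_le.2 (opt_le hB)
    _ = |(d : ℝ)| * ∑ A, y (Sum.inl A) := by
      rw [Fintype.card_sigma, mul_sum]
      push_cast
      simp [hm]
    _ ≤ d.natAbs * ∑ A, x A := by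
      rw [hd]
      refine mul_le_mul_of_nonneg_left ?_ (abs_nonneg _)
      simpa [Fintype.sum_sum_type] using hyc

end Packing

/-! ### Schedules as fractional covers, and packings as schedules. -/

section Schedule

variable {n : ℕ} {I : ElectricityInstance n}

theorem Schedule.length_pos (s : I.Schedule) (l : Fin s.p) : 0 < s.t l.succ - s.t l.castSucc :=
  sub_pos.2 (s.t_strictMono Fin.castSucc_lt_succ)

theorem Schedule.sum_length (s : I.Schedule) :
    ∑ l : Fin s.p, (s.t l.succ - s.t l.castSucc) = I.T := by
  have h := (Fin.sum_univ_succ s.t).symm.trans (Fin.sum_univ_castSucc s.t)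
  rw [s.t_zero, s.t_last] at h
  rw [sum_sub_distrib]
  linarith

theorem Schedule.exists_opt_le {N : ℕ} (hN : ∀ M : Matrix (Fin n) (Fin n) ℤ,
    (∀ i j, M i j = 0 ∨ M i j = 1) → |M.det| ≤ N) (s : I.Schedule) {u : ℝ} (hu : 0 < u)
    (hle : ∀ i, u ≤ s.utility i) : ∃ k, 1 ≤ k ∧ k ≤ N ∧ (I.opt k : ℝ) * u ≤ k * I.T := by
  classical
  let g : Fin s.p → {A // I.Feasible A} := fun l => ⟨s.A l, s.feasible l⟩
  let len : Fin s.p → ℝ := fun l => s.t l.succ - s.t l.castSucc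
  obtain ⟨k, hk1, hkN, hk⟩ := exists_opt_le_of_fractional_cover hN
    -- The weight of `A` is its total connection time over `u`: each household gets at least 1, and
    -- the total is `T / u`.
    (x := fun A => (∑ l with g l = A, len l) / u)
    (fun A => div_nonneg (sum_nonneg fun l _ => (s.length_pos l).le) hu.le) fun i => by
      have h : ∀ A : {A // I.Feasible A}, (if i ∈ A.1 then (∑ l with g l = A, len l) / u else 0) =
          ∑ l with g l = A, (if i ∈ s.A l then len l else 0) / u := by
        intro A
        rw [← sum_div]
        by_cases hi : i ∈ A.1
        · rw [if_pos hi]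
          congr 1
          refine sum_congr rfl fun l hl => ?_
          rw [mem_filter_univ] at hl
          rw [if_pos (by rw [← hl] at hi; exact hi)]
        · rw [if_neg hi, sum_eq_zero, zero_div]
          intro l hl
          rw [mem_filter_univ] at hl
          rw [if_neg (by rw [← hl] at hi; exact hi)]
      rw [sum_congr rfl fun A _ => h A, sum_fiberwise, ← sum_div, ← sum_filter, le_div_iff₀ hu,
        one_mul]
      exact hle i
  refine ⟨k, hk1, hkN, ?_⟩
  rw [← sum_div, sum_fiberwise, s.sum_length, ← mul_div_assoc, le_div_iff₀ hu] at hk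
  exact hk

theorem IsPacking.pos [NeZero n] {k q : ℕ} (hk : 1 ≤ k) {B : Fin q → Finset (Fin n)}
    (hB : I.IsPacking k B) : 0 < q := by
  have h := (hB.2 0).symm.le.trans (card_le_univ _)
  rw [Fintype.card_fin] at h
  omega

/-- Connecting each bin of a `k`-times bin packing into `q` bins for the same time connects every
household for the fraction `k / q` of the time. -/
theorem IsPacking.exists_schedule {k q : ℕ} (hq : 0 < q) {B : Fin q → Finset (Fin n)}
    (hB : I.IsPacking k B) : ∃ s : I.Schedule, ∀ i, s.utility i = (k : ℝ) / q * I.T := by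
  have hq' : (0 : ℝ) < q := Nat.cast_pos.2 hq
  refine ⟨⟨q, fun j => j / q * I.T, fun a b hab => ?_, by simp, ?_, B, hB.1⟩, fun i => ?_⟩
  · have hab' : ((a : ℕ) : ℝ) < (b : ℕ) := Nat.cast_lt.2 hab
    have := I.T_pos
    dsimp only
    gcongr
  · simp [hq'.ne']
  · simp only [Schedule.utility, Fin.val_succ, Fin.val_castSucc]
    rw [sum_congr rfl fun l _ => (by push_cast; ring :
      ((l.val + 1 : ℕ) : ℝ) / q * I.T - (l.val : ℝ) / q * I.T = 1 / q * I.T), sum_const, hB.2 i,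
      nsmul_eq_mul]
    ring

theorem IsPacking.mem_range [NeZero n] {k q : ℕ} (hk : 1 ≤ k) {B : Fin q → Finset (Fin n)}
    (hB : I.IsPacking k B) :
    (k : ℝ) / q * I.T ∈ Set.range fun s : I.Schedule => ⨅ i, s.utility i := by
  obtain ⟨s, hs⟩ := hB.exists_schedule (hB.pos hk)
  exact ⟨s, by simp [hs]⟩

theorem opt_pos [NeZero n] (I : ElectricityInstance n) {k : ℕ} (hk : 1 ≤ k) : 0 < I.opt k := by
  obtain ⟨B, hB⟩ := I.isPacking_opt k
  exact hB.pos hk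

theorem exists_isSolvedBy_le [NeZero n] (I : ElectricityInstance n) {N : ℕ} (hN1 : 1 ≤ N)
    (hN : ∀ M : Matrix (Fin n) (Fin n) ℤ, (∀ i j, M i j = 0 ∨ M i j = 1) → |M.det| ≤ N) :
    ∃ k ≤ N, I.IsSolvedBy k := by
  -- One `k` must serve against all schedules, whereas `Schedule.exists_opt_le` gives one per
  -- schedule; the minimizer of `opt k / k` dominates them.
  obtain ⟨k, hk, hmin⟩ := exists_min_image (Icc 1 N) (fun k => (I.opt k : ℝ) / k)
    ⟨1, mem_Icc.2 ⟨le_rfl, hN1⟩⟩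
  rw [mem_Icc] at hk
  obtain ⟨B, hB⟩ := I.isPacking_opt k
  refine ⟨k, hk.2, hk.1, hB.mem_range hk.1, ?_⟩
  rintro _ ⟨s, rfl⟩
  have hT := I.T_pos
  have hq : (0 : ℝ) < I.opt k := Nat.cast_pos.2 (I.opt_pos hk.1)
  have hk0 : (0 : ℝ) < k := Nat.cast_pos.2 hk.1
  rcases le_or_gt (⨅ i, s.utility i) 0 with hu | hu
  · exact hu.trans (by positivity)
  obtain ⟨m, hm1, hmN, hm⟩ := s.exists_opt_le hN hu fun i => ciInf_le (Set.finite_range _).bddBelow i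
  have hm0 : (0 : ℝ) < m := Nat.cast_pos.2 hm1
  have h := hmin m (mem_Icc.2 ⟨hm1, hmN⟩)
  have h1 : (I.opt m : ℝ) / m * (⨅ i, s.utility i) ≤ I.T := by
    rw [div_mul_eq_mul_div, div_le_iff₀ hm0]
    linarith
  have h2 := (mul_le_mul_of_nonneg_right h hu.le).trans h1
  rw [div_mul_eq_mul_div, div_le_iff₀ hk0] at h2
  dsimp only
  rw [div_mul_eq_mul_div, le_div_iff₀ hq]
  linarith

theorem leastK_le {k : ℕ} (h : I.IsSolvedBy k) : I.leastK ≤ k :=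
  iInf₂_le k h

theorem IsPacking.mul_sum_le {k q : ℕ} {B : Fin q → Finset (Fin n)} (hB : I.IsPacking k B) :
    k * ∑ i, I.D i ≤ q * I.S := by
  calc k * ∑ i, I.D i = ∑ i, ∑ j with i ∈ B j, I.D i := by
        simp [hB.2, mul_sum]
    _ = ∑ j, ∑ i ∈ B j, I.D i := sum_comm' (by simp)
    _ ≤ ∑ _j : Fin q, I.S := sum_le_sum fun j _ => hB.1 j
    _ = q * I.S := by simp

end Schedule

/-! ### Six households and the extremal instance. -/

section SixHouseholds

theorem exists_isSolvedBy_le_nine (I : ElectricityInstance 6) : ∃ k ≤ 9, I.IsSolvedBy k :=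
  I.exists_isSolvedBy_le (by norm_num) fun _ hM => abs_det_le_nine hM

theorem leastK_le_nine (I : ElectricityInstance 6) : I.leastK ≤ 9 := by
  obtain ⟨k, hk, h⟩ := I.exists_isSolvedBy_le_nine
  exact (leastK_le h).trans (by exact_mod_cast hk)

/-- A `9`-times bin packing of the demands `4, 2, 5, 3, 2, 1` into `17` bins of capacity `9`, all
of them full. -/
def fullBins (j : Fin 17) : Finset (Fin 6) :=
  (![{2, 3, 5}, {1, 2, 4}, {0, 3, 4}, {0, 2}, {0, 1, 4, 5}, {0, 1, 3}] : Fin 6 → Finset (Fin 6))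
    ((![0, 0, 0, 0, 0, 1, 1, 1, 2, 2, 3, 4, 4, 4, 4, 5, 5] : Fin 17 → Fin 6) j)

variable {I : ElectricityInstance 6}

theorem sum_fullBins (hS : I.S = 9) (hD : I.D = ![4, 2, 5, 3, 2, 1]) (j : Fin 17) :
    ∑ i ∈ fullBins j, I.D i = I.S := by
  unfold fullBins
  generalize (![0, 0, 0, 0, 0, 1, 1, 1, 2, 2, 3, 4, 4, 4, 4, 5, 5] : Fin 17 → Fin 6) j = a
  rw [hS, hD]
  fin_cases a <;> simp <;> norm_num

theorem isPacking_fullBins (hS : I.S = 9) (hD : I.D = ![4, 2, 5, 3, 2, 1]) :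
    I.IsPacking 9 fullBins :=
  ⟨fun j => (sum_fullBins hS hD j).le, by decide⟩

theorem seventeen_mul_le_of_isPacking (hS : I.S = 9) (hD : I.D = ![4, 2, 5, 3, 2, 1]) {k q : ℕ}
    {B : Fin q → Finset (Fin 6)} (hB : I.IsPacking k B) : 17 * k ≤ 9 * q := by
  have h := hB.mul_sum_le
  have h17 : ∑ i, I.D i = 17 := by
    rw [hD]
    simp [Fin.sum_univ_succ]
    norm_num
  rw [hS, h17] at h
  have h' : (k * 17 : ℕ) ≤ (q * 9 : ℕ) := by exact_mod_cast h
  omega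

theorem opt_nine_eq (hS : I.S = 9) (hD : I.D = ![4, 2, 5, 3, 2, 1]) : I.opt 9 = 17 := by
  refine le_antisymm (opt_le (isPacking_fullBins hS hD)) ?_
  obtain ⟨B, hB⟩ := I.isPacking_opt 9
  have := seventeen_mul_le_of_isPacking hS hD hB
  omega

/-- One inequality is the volume bound; the other holds because the optimum is at least the time `9
/ 17 * T` given by the full bins. -/
theorem seventeen_mul_eq_of_isSolvedBy (hS : I.S = 9) (hD : I.D = ![4, 2, 5, 3, 2, 1]) {k : ℕ}
    (hk : I.IsSolvedBy k) : 17 * k = 9 * I.opt k := by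
  obtain ⟨B, hB⟩ := I.isPacking_opt k
  refine le_antisymm (seventeen_mul_le_of_isPacking hS hD hB) ?_
  have h := hk.2.2 ((isPacking_fullBins hS hD).mem_range (by norm_num))
  have h1 := le_of_mul_le_mul_right h I.T_pos
  rw [div_le_div_iff₀ (by norm_num) (Nat.cast_pos.2 (I.opt_pos hk.1))] at h1
  have h' : 9 * I.opt k ≤ k * 17 := by exact_mod_cast h1
  omega

theorem leastK_eq_nine (hS : I.S = 9) (hD : I.D = ![4, 2, 5, 3, 2, 1]) : I.leastK = 9 := by
  refine le_antisymm I.leastK_le_nine (le_iInf₂ fun k hk => ?_)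
  have h := seventeen_mul_eq_of_isSolvedBy hS hD hk
  have h1 := hk.1
  have h9 : 9 ≤ k := by omega
  exact_mod_cast h9

theorem exists_instance : ∃ I : ElectricityInstance 6, I.S = 9 ∧ I.D = ![4, 2, 5, 3, 2, 1] :=
  ⟨⟨9, ![4, 2, 5, 3, 2, 1], 1, by norm_num, by intro i; fin_cases i <;> simp,
    by intro i; fin_cases i <;> simp <;> norm_num, one_pos⟩, rfl, rfl⟩

end SixHouseholds

end ElectricityInstance

theorem mainTheorem7 :
    maxLeastK 6 = 9 ∧
      ∀ I : ElectricityInstance 6, I.S = 9 → I.D = ![4, 2, 5, 3, 2, 1] →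
        I.leastK = 9 ∧ I.opt 9 = 17 ∧
          ∃ B : Fin 17 → Finset (Fin 6), I.IsPacking 9 B ∧ ∀ j, ∑ i ∈ B j, I.D i = I.S := by
  refine ⟨le_antisymm (iSup_le fun I => I.leastK_le_nine) ?_, fun I hS hD =>
    ⟨ElectricityInstance.leastK_eq_nine hS hD, ElectricityInstance.opt_nine_eq hS hD,
      ElectricityInstance.fullBins, ElectricityInstance.isPacking_fullBins hS hD,
      ElectricityInstance.sum_fullBins hS hD⟩⟩
  obtain ⟨I, hS, hD⟩ := ElectricityInstance.exists_instance
  exact (ElectricityInstance.leastK_eq_nine hS hD).symm.le.trans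
    (le_iSup (fun I : ElectricityInstance 6 => I.leastK) I)
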